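/- **Conventions.** $\mathbb N=\{0,1,2,\dots\}$. Let $(X,\mu)$ be a standard Lebesgue probability space (isomorphic modulo null sets to $[0,1]$ with Lebesgue measure) and let $T:X\to X$ be a transformation, i.e. a $\mu$-preserving map that is invertible almost everywhere with $\mu$-preserving inverse. A system $(X,\mu,T)$ *factors onto* $(Y,\nu,S)$ if there is a measure-preserving map $\varphi:X\to Y$, onto up to a null set, with $\varphi\circ T=S\circ\varphi$ $\mu$-almost everywhere. *Rank-one.* $T$ is rank-one if there are integers $r_n>1$ (cutting parameter) and $s_{n,i}\ge 0$, $0<i\le r_n$ (spacer parameter), such that, with $h_0=1$ and $h_{n+1}=r_nh_n+\sum_{0<i\le r_n}s_{n,i}$, one has $\sum_n (h_{n+1}-r_nh_n)/h_{n+1}<\infty$, and there are measurable sets $B_n$, $B_{n,i}$ ($0<i\le r_n$) and $C_{n,i,j}$ ($0<i\le r_n$, $0<j\le s_{n,i}$), contained in a set of full measure that $T$ maps bijectively onto itself, such that for all $n$: the $B_{n,i}$, $0<i\le r_n$, partition $B_n$; the sets $T^k(B_n)$, $0\le k<h_n$, are pairwise disjoint; $T^{h_n}(B_{n,i})=C_{n,i,1}$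 if $s_{n,i}\ne 0$; $T^{h_n}(B_{n,i})=B_{n,i+1}$ if $s_{n,i}=0$ and $i<r_n$; $T(C_{n,i,j})=C_{n,i,j+1}$ if $j<s_{n,i}$; $T(C_{n,i,s_{n,i}})=B_{n,i+1}$ if $i<r_n$ and $s_{n,i}\neq0$; $B_{n+1}=B_{n,1}$; and for every measurable $A\subseteq X$ and $\varepsilon>0$ there are $n$ and $J\subseteq\{0,\dots,h_n-1\}$ with $\mu\bigl(A\,\triangle\,\bigcup_{k\in J}T^k(B_n)\bigr)<\varepsilon$. For $m\le n$ let $$I_{m,n}=\{\,i : 0\le i<h_n,\ T^i(B_n)\subseteq B_m\,\}.$$ *Cyclic permutations and odometers.* For $k>1$, $\mathbb Z/k\mathbb Z$ also denotes the system $i\mapsto i+1$ on $\mathbb Z/k\mathbb Z$ with the uniform probability measure. Given an unbounded sequence of integers $k_n>1$ with $k_n\mid k_{n+1}$ for all $n$, the associated *odometer* is the map $\alpha\mapsto(\alpha_n+1)_n$ on the group of all $\alpha\in\prod_n\mathbb Z/k_n\mathbb Z$ with $\alpha_n\equiv\alpha_m \pmod{k_m}$ for $m\le n$, equipped with its normalized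 Haar measure (which gives measure $1/k_n$ to each set $\{\alpha:\alpha_n=i\}$). **Corollary.** Let $(X,\mu,T)$ be a rank-one transformation, with $h_n$, $B_n$, $I_{m,n}$ as above for some choice of the rank-one data. The following are equivalent. 1. $(X,\mu,T)$ factors onto some odometer. 2. For every $M\in\mathbb N$ there is an integer $k\ge M$, $k>1$, such that for every $\eta>0$ there is $N\in\mathbb N$ such that for all $n\ge m\ge N$ there is $j\in\mathbb Z/k\mathbb Z$ with $$\frac{|\{i\in I_{m,n} : i\not\equiv j \ (\mathrm{mod}\ k)\}|}{|I_{m,n}|}<\eta .$$ 3. For every $M\in\mathbb N$ there is an integer $k\ge M$, $k>1$, such that $(X,\mu,T)$ factors onto $\mathbb Z/k\mathbb Z$. -/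

import Mathlib

open MeasureTheory Set

noncomputable section

/-! ## Measure-preserving systems

All notions are taken modulo null sets; "measurable" always refers to the completed
sigma-algebra (`NullMeasurableSet`), so that the underlying sigma-algebra may be complete or not. -/

/-- `φ : (X, μ) → (Y, ν)` is measure preserving: preimages of measurable sets are `μ`-measurable
and have the right measure. -/
structure IsMeasurePreservingMap {X Y : Type*} [MeasurableSpace X] [MeasurableSpace Y]
    (φ : X → Y) (μ : Measure X) (ν : Measure Y) : Prop where
  nullMeasurable : NullMeasurable φ μ
  measure_preimage : ∀ A : Set Y, MeasurableSet A → μ (φ ⁻¹' A) = ν A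

/-- A standard (nonatomic) Lebesgue probability space: isomorphic modulo null sets to the unit
interval with Lebesgue measure. -/
def IsStandardLebesgueSpace {X : Type*} [MeasurableSpace X] (μ : Measure X) : Prop :=
  ∃ (φ : X → unitInterval) (ψ : unitInterval → X),
    IsMeasurePreservingMap φ μ volume ∧ IsMeasurePreservingMap ψ volume μ ∧
    (∀ᵐ x ∂μ, ψ (φ x) = x) ∧ (∀ᵐ t : unitInterval, φ (ψ t) = t)

/-- A transformation of `(X, μ)`: a measure-preserving self-map, invertible almost everywhere,
with measure-preserving inverse. -/
def IsTransformation {X : Type*} [MeasurableSpace X] (T : X → X) (μ : Measure X) : Prop :=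
  IsMeasurePreservingMap T μ μ ∧
    ∃ S : X → X, IsMeasurePreservingMap S μ μ ∧
      (∀ᵐ x ∂μ, S (T x) = x) ∧ (∀ᵐ x ∂μ, T (S x) = x)

/-- `(X, μ, T)` factors onto `(Y, ν, S)`: there is a measure-preserving map, onto up to a null
set, that intertwines `T` and `S` almost everywhere. -/
def FactorsOnto {X Y : Type*} [MeasurableSpace X] [MeasurableSpace Y]
    (T : X → X) (μ : Measure X) (S : Y → Y) (ν : Measure Y) : Prop :=
  ∃ φ : X → Y, IsMeasurePreservingMap φ μ ν ∧ (∀ᵐ x ∂μ, φ (T x) = S (φ x)) ∧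
    (∀ᵐ y ∂ν, y ∈ Set.range φ)

/-! ## Rank-one transformations -/

/-- Heights of the towers: `h 0 = 1`, `h (n+1) = r n * h n + ∑_{0 < i ≤ r n} s n i`. -/
def towerHeight (r : ℕ → ℕ) (s : ℕ → ℕ → ℕ) : ℕ → ℕ
  | 0 => 1
  | n + 1 => r n * towerHeight r s n + ∑ i ∈ Finset.Icc 1 (r n), s n i

/-- A cutting-and-stacking construction of `T`. -/
structure RankOneConstruction {X : Type*} [MeasurableSpace X] (T : X → X) (μ : Measure X) where
  /-- cutting parameter -/
  r : ℕ → ℕ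
  /-- spacer parameter; `s n i` is used for `0 < i ≤ r n` -/
  s : ℕ → ℕ → ℕ
  one_lt_r : ∀ n, 1 < r n
  summable_spacers : Summable fun n : ℕ =>
    ((towerHeight r s (n + 1) : ℝ) - (r n : ℝ) * (towerHeight r s n : ℝ)) /
      (towerHeight r s (n + 1) : ℝ)
  /-- a set of full measure on which `T` is an honest bijection and in which the construction
  takes place -/
  dom : Set X
  dom_conull : μ domᶜ = 0
  bijOn_dom : Set.BijOn T dom dom
  /-- base of the stage-`n` tower -/
  B : ℕ → Set X
  /-- base of the `i`-th `n`-block, `0 < i ≤ r n` -/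
  Bsub : ℕ → ℕ → Set X
  /-- spacers, `C n i j` for `0 < i ≤ r n`, `0 < j ≤ s n i` -/
  C : ℕ → ℕ → ℕ → Set X
  B_subset_dom : ∀ n, B n ⊆ dom
  nullMeasurableSet_B : ∀ n, NullMeasurableSet (B n) μ
  iUnion_Bsub : ∀ n, ⋃ i ∈ Set.Icc 1 (r n), Bsub n i = B n
  disjoint_Bsub : ∀ n, (Set.Icc 1 (r n)).PairwiseDisjoint (Bsub n)
  disjoint_levels : ∀ n, (Set.Iio (towerHeight r s n)).PairwiseDisjoint fun k => T^[k] '' B n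
  image_Bsub_of_ne : ∀ n i, 1 ≤ i → i ≤ r n → s n i ≠ 0 →
    T^[towerHeight r s n] '' Bsub n i = C n i 1
  image_Bsub_of_eq : ∀ n i, 1 ≤ i → i < r n → s n i = 0 →
    T^[towerHeight r s n] '' Bsub n i = Bsub n (i + 1)
  image_C : ∀ n i j, 1 ≤ i → i ≤ r n → 1 ≤ j → j < s n i → T '' C n i j = C n i (j + 1)
  image_C_last : ∀ n i, 1 ≤ i → i < r n → s n i ≠ 0 → T '' C n i (s n i) = Bsub n (i + 1)
  B_succ : ∀ n, B (n + 1) = Bsub n 1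
  /-- every measurable set is approximated by unions of levels of a tower -/
  dense_levels : ∀ A : Set X, NullMeasurableSet A μ → ∀ ε : ℝ, 0 < ε →
    ∃ (n : ℕ) (J : Set ℕ), J ⊆ Set.Iio (towerHeight r s n) ∧
      μ (symmDiff A (⋃ k ∈ J, T^[k] '' B n)) < ENNReal.ofReal ε

namespace RankOneConstruction

variable {X : Type*} [MeasurableSpace X] {T : X → X} {μ : Measure X}

/-- Height of the stage-`n` tower. -/
def h (R : RankOneConstruction T μ) (n : ℕ) : ℕ := towerHeight R.r R.s n

open Classical in
/-- `I_{m,n}`: the indices of the levels of the stage-`n` tower contained in the base of the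
stage-`m` tower. -/
def I (R : RankOneConstruction T μ) (m n : ℕ) : Finset ℕ :=
  (Finset.range (R.h n)).filter fun i => T^[i] '' R.B n ⊆ R.B m

/-- The counting condition: for every `η > 0`, for all large `m ≤ n`, all but a proportion less
than `η` of the elements of `I_{m,n}` lie in one residue class mod `k`. -/
def CountingCondition (R : RankOneConstruction T μ) (k : ℕ) : Prop :=
  ∀ η : ℝ, 0 < η → ∃ N : ℕ, ∀ m n : ℕ, N ≤ m → m ≤ n → ∃ j : ZMod k,
    (((R.I m n).filter fun i : ℕ => (i : ZMod k) ≠ j).card : ℝ) / ((R.I m n).card : ℝ) < η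

end RankOneConstruction

/-! ## Finite cyclic permutations -/

/-- The cyclic permutation `i ↦ i + 1` of `ℤ/kℤ`. -/
def cyclicMap (k : ℕ) : ZMod k → ZMod k := fun i => i + 1

/-- The measure giving each point of `ℤ/kℤ` mass `1/k`. -/
def cyclicMeasure (k : ℕ) : Measure (ZMod k) := (k : ENNReal)⁻¹ • Measure.count

/-! ## Odometers -/

/-- A divisibility chain of integers greater than `1`, with infinitely many different terms. -/
structure OdometerScale where
  k : ℕ → ℕ
  one_lt : ∀ n, 1 < k n
  dvd_succ : ∀ n, k n ∣ k (n + 1)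
  unbounded : ∀ M, ∃ n, M ≤ k n

namespace OdometerScale

variable (K : OdometerScale)

theorem dvd_of_le {m n : ℕ} (hmn : m ≤ n) : K.k m ∣ K.k n := by
  induction hmn with
  | refl => exact dvd_rfl
  | step _ ih => exact ih.trans (K.dvd_succ _)

instance neZero (n : ℕ) : NeZero (K.k n) := ⟨by have := K.one_lt n; omega⟩

/-- The compact group of all coherent sequences `α ∈ ∏ ℤ/k_nℤ`, i.e. `[α_n]_{k_m} = α_m` for
`m ≤ n`. -/
def space : AddSubgroup (∀ n, ZMod (K.k n)) where
  carrier := {α | ∀ m n, ∀ hmn : m ≤ n,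
    ZMod.castHom (K.dvd_of_le hmn) (ZMod (K.k m)) (α n) = α m}
  add_mem' := by
    intro a b ha hb m n hmn
    simp only [Pi.add_apply, map_add]
    rw [ha m n hmn, hb m n hmn]
  zero_mem' := by
    intro m n hmn
    simp only [Pi.zero_apply, map_zero]
  neg_mem' := by
    intro a ha m n hmn
    simp only [Pi.neg_apply, map_neg]
    rw [ha m n hmn]

/-- The constant sequence `(1, 1, …)`. -/
def one : K.space := ⟨fun _ => 1, fun _ _ _ => map_one _⟩

/-- The odometer map: add `1` in every coordinate. -/
def map (α : K.space) : K.space := α + K.one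

theorem isClosed_space : IsClosed (K.space : Set (∀ n, ZMod (K.k n))) := by
  have h : (K.space : Set (∀ n, ZMod (K.k n))) = ⋂ m, ⋂ n, ⋂ hmn : m ≤ n,
      {α | ZMod.castHom (K.dvd_of_le hmn) (ZMod (K.k m)) (α n) = α m} := by
    ext α
    simp only [Set.mem_iInter]
    rfl
  rw [h]
  refine isClosed_iInter fun m => isClosed_iInter fun n => isClosed_iInter fun hmn => ?_
  exact isClosed_eq (continuous_of_discreteTopology.comp (continuous_apply n)) (continuous_apply m)

instance compactSpace : CompactSpace K.space :=
  isCompact_iff_compactSpace.mp K.isClosed_space.isCompact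

instance borelSpace : BorelSpace K.space := by
  have : BorelSpace (∀ n, ZMod (K.k n)) := inferInstance
  exact Subtype.borelSpace _

/-- The natural measure: normalized Haar measure. It gives measure `1/k_n` to each set
`{α | α_n = i}`, see `measure_cylinder`. -/
def measure : Measure K.space := Measure.addHaarMeasure ⊤

theorem measure_univ : K.measure Set.univ = 1 :=
  Measure.addHaarMeasure_self (K₀ := (⊤ : TopologicalSpace.PositiveCompacts K.space))

theorem measure_cylinder (n : ℕ) (i : ZMod (K.k n)) :
    K.measure {α | α.1 n = i} = (K.k n : ENNReal)⁻¹ := by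
  have hinv : K.measure.IsAddLeftInvariant := by unfold measure; infer_instance
  have hmeas : ∀ i : ZMod (K.k n), MeasurableSet {α : K.space | α.1 n = i} := fun i => by
    have hm : Measurable fun α : K.space => α.1 n :=
      (measurable_pi_apply n).comp measurable_subtype_coe
    exact hm (measurableSet_singleton i)
  have hone : ∀ c : ℕ, (c • K.one).1 n = (c : ZMod (K.k n)) := by
    intro c
    simp [one]
  have heq : ∀ i : ZMod (K.k n), K.measure {α | α.1 n = i} = K.measure {α | α.1 n = 0} := by
    intro i
    rw [← measure_preimage_add K.measure (i.val • K.one) {α | α.1 n = i}]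
    congr 1
    ext α
    have h1 : ((i.val • K.one + α).1 n = i) ↔ α.1 n = 0 := by
      have h2 : (i.val • K.one + α).1 n = i + α.1 n := by
        have h3 := hone i.val
        rw [ZMod.natCast_zmod_val] at h3
        change (i.val • K.one).1 n + α.1 n = _
        rw [h3]
      rw [h2]
      simp
    exact h1
  have hsum : ∑ i : ZMod (K.k n), K.measure {α | α.1 n = i} = 1 := by
    rw [← K.measure_univ, ← measure_biUnion_finset _ fun i _ => hmeas i]
    · congr 1
      ext α
      simp
    · intro a _ b _ hab
      refine Set.disjoint_left.mpr fun α h1 h2 => hab ?_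
      exact h1.symm.trans h2
  simp only [heq, Finset.sum_const, Finset.card_univ, ZMod.card, nsmul_eq_mul] at hsum
  rw [heq i]
  exact ENNReal.eq_inv_of_mul_eq_one_left (by rw [mul_comm]; exact hsum)

end OdometerScale

end

/-! The implications run 1 ⇒ 3 ⇒ 2 ⇒ 1. For 1 ⇒ 3, a coordinate of the odometer is a map to `ZMod
(K.k n)` that intertwines `T` with adding 1.

For 3 ⇒ 2, let `φ` map to `ℤ/k`. A late tower approximates the fiber over 0 by a union of levels,
and each residue occurs among about `1/k` of the levels. So every fiber fills either almost none or
almost all of the base, and one of them fills almost all (`eventually_concentrated`). If `B m` sits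
mostly over `c` and `B n` mostly over `d`, then the copies `T^[i] '' B n` inside `B m` must mostly
have `i ≡ c - d` (`countingCondition_of_equivariant`).

For 2 ⇒ 1, the counting condition passes to least common multiples, so it holds along a divisibility
chain. Passing from tower `m` to tower `n` changes the level index of a point by an element of `I m
n`, hence, off a small set, by a constant mod `k`. Subtracting these constants along a fast sequence
of stages, Borel–Cantelli gives convergence in the odometer (`exists_approximate_factor`). The limit
is equivariant, hence uniform on cylinders, hence measure preserving; a Lusin argument shows that
its range is conull (`ae_mem_range`). -/

noncomputable section

/-! ## Measure-preserving maps modulo null sets -/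

namespace IsMeasurePreservingMap

variable {X Y Z : Type*} [MeasurableSpace X] [MeasurableSpace Y] [MeasurableSpace Z]
  {φ : X → Y} {g : Y → Z} {μ : Measure X} {ν : Measure Y} {ρ : Measure Z}

theorem measure_preimage_null (hφ : IsMeasurePreservingMap φ μ ν) {A : Set Y} (hA : ν A = 0) :
    μ (φ ⁻¹' A) = 0 := by
  refine measure_mono_null (preimage_mono (subset_toMeasurable ν A)) ?_
  rw [hφ.measure_preimage _ (measurableSet_toMeasurable _ _), measure_toMeasurable, hA]

theorem ae_comp (hφ : IsMeasurePreservingMap φ μ ν) {p : Y → Prop} (hp : ∀ᵐ y ∂ν, p y) :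
    ∀ᵐ x ∂μ, p (φ x) :=
  hφ.measure_preimage_null hp

theorem preimage_ae_eq (hφ : IsMeasurePreservingMap φ μ ν) {A B : Set Y} (h : A =ᵐ[ν] B) :
    (φ ⁻¹' A : Set X) =ᵐ[μ] (φ ⁻¹' B : Set X) :=
  hφ.ae_comp h

theorem nullMeasurableSet_preimage (hφ : IsMeasurePreservingMap φ μ ν) {A : Set Y}
    (hA : NullMeasurableSet A ν) : NullMeasurableSet (φ ⁻¹' A) μ := by
  obtain ⟨B, -, hB, hBA⟩ := hA.exists_measurable_superset_ae_eq
  exact (hφ.nullMeasurable hB).congr (hφ.preimage_ae_eq hBA)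

theorem measure_preimage₀ (hφ : IsMeasurePreservingMap φ μ ν) {A : Set Y}
    (hA : NullMeasurableSet A ν) : μ (φ ⁻¹' A) = ν A := by
  obtain ⟨B, -, hB, hBA⟩ := hA.exists_measurable_superset_ae_eq
  rw [← measure_congr hBA, ← hφ.measure_preimage B hB]
  exact measure_congr (hφ.preimage_ae_eq hBA.symm)

theorem comp (hg : IsMeasurePreservingMap g ν ρ) (hφ : IsMeasurePreservingMap φ μ ν) :
    IsMeasurePreservingMap (g ∘ φ) μ ρ where
  nullMeasurable _ hA := hφ.nullMeasurableSet_preimage (hg.nullMeasurable hA)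
  measure_preimage A hA := by
    rw [preimage_comp, hφ.measure_preimage₀ (hg.nullMeasurable hA), hg.measure_preimage A hA]

theorem id : IsMeasurePreservingMap (fun x : X => x) μ μ :=
  ⟨fun _ hA => hA.nullMeasurableSet, fun _ _ => rfl⟩

theorem iterate {T : X → X} (hT : IsMeasurePreservingMap T μ μ) (n : ℕ) :
    IsMeasurePreservingMap T^[n] μ μ := by
  induction n with
  | zero => exact IsMeasurePreservingMap.id
  | succ n ih => exact ih.comp hT

theorem isProbabilityMeasure [IsProbabilityMeasure ν] (hφ : IsMeasurePreservingMap φ μ ν) :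
    IsProbabilityMeasure μ :=
  ⟨by rw [← preimage_univ (f := φ), hφ.measure_preimage _ .univ, measure_univ]⟩

end IsMeasurePreservingMap

theorem IsStandardLebesgueSpace.isProbabilityMeasure {X : Type*} [MeasurableSpace X]
    {μ : Measure X} (hX : IsStandardLebesgueSpace μ) : IsProbabilityMeasure μ :=
  let ⟨_, _, hφ, _⟩ := hX
  hφ.isProbabilityMeasure

/-- On a set that `T` maps bijectively onto itself up to null sets, `T` preserves the measure of
images. -/
theorem IsTransformation.image_ae_eq {X : Type*} [MeasurableSpace X] {μ : Measure X} {T : X → X}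
    (hT : IsTransformation T μ) {D : Set X} (hD : μ Dᶜ = 0) (hbij : BijOn T D D) {A : Set X}
    (hAD : A ⊆ D) (hA : NullMeasurableSet A μ) :
    NullMeasurableSet (T '' A) μ ∧ μ (T '' A) = μ A := by
  obtain ⟨-, S, hS, -, hTS⟩ := hT
  -- Up to a null set the image is a preimage under the inverse, which carries both measurability
  -- and measure.
  have h : (S ⁻¹' A : Set X) =ᵐ[μ] (T '' A : Set X) := by
    have hSD : ∀ᵐ x ∂μ, S x ∈ D := hS.ae_comp (p := (· ∈ D)) hD
    filter_upwards [hTS, hSD] with y hy hyD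
    refine propext ⟨fun hyA => ⟨S y, hyA, hy⟩, ?_⟩
    rintro ⟨x, hxA, rfl⟩
    have := hbij.injOn hyD (hAD hxA) hy
    change S (T x) ∈ A
    rwa [this]
  exact ⟨(hS.nullMeasurableSet_preimage hA).congr h, by
    rw [← measure_congr h, hS.measure_preimage₀ hA]⟩

theorem IsTransformation.image_iterate {X : Type*} [MeasurableSpace X] {μ : Measure X} {T : X → X}
    (hT : IsTransformation T μ) {D : Set X} (hD : μ Dᶜ = 0) (hbij : BijOn T D D) {A : Set X}
    (hAD : A ⊆ D) (hA : NullMeasurableSet A μ) (n : ℕ) :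
    NullMeasurableSet (T^[n] '' A) μ ∧ μ (T^[n] '' A) = μ A := by
  induction n with
  | zero => simpa using hA
  | succ n ih =>
    have h := hT.image_ae_eq hD hbij (A := T^[n] '' A)
      ((hbij.mapsTo.iterate n).mono_left hAD).image_subset ih.1
    rw [Function.iterate_succ', image_comp]
    exact ⟨h.1, h.2.trans ih.2⟩

theorem IsTransformation.measure_image_iterate_inter {X : Type*} [MeasurableSpace X]
    {μ : Measure X} {T : X → X} (hT : IsTransformation T μ) {D : Set X} (hD : μ Dᶜ = 0)
    (hbij : BijOn T D D) {A E : Set X} (hAD : A ⊆ D) (hA : NullMeasurableSet A μ)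
    (hE : NullMeasurableSet E μ) (n : ℕ) :
    μ (T^[n] '' A ∩ E) = μ (A ∩ T^[n] ⁻¹' E) := by
  rw [← image_inter_preimage]
  exact (hT.image_iterate hD hbij (inter_subset_left.trans hAD)
    (hA.inter ((hT.1.iterate n).nullMeasurableSet_preimage hE)) n).2

/-! ## Combinatorics of the towers -/

namespace RankOneConstruction

variable {X : Type*} [MeasurableSpace X] {T : X → X} {μ : Measure X}

theorem h_zero (R : RankOneConstruction T μ) : R.h 0 = 1 := rfl

theorem h_succ (R : RankOneConstruction T μ) (n : ℕ) :
    R.h (n + 1) = R.r n * R.h n + ∑ i ∈ Finset.Icc 1 (R.r n), R.s n i := rfl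

theorem two_pow_le_h (R : RankOneConstruction T μ) (n : ℕ) : 2 ^ n ≤ R.h n := by
  induction n with
  | zero => simp [h_zero]
  | succ n ih =>
    rw [h_succ, pow_succ]
    have := Nat.mul_le_mul (R.one_lt_r n) ih
    omega

theorem h_pos (R : RankOneConstruction T μ) (n : ℕ) : 0 < R.h n :=
  (Nat.two_pow_pos n).trans_le (R.two_pow_le_h n)

/-- The offset, inside the tower of stage `n + 1`, of the `q`-th copy of the tower of stage `n`,
counting from `0`. -/
def offset (R : RankOneConstruction T μ) (n q : ℕ) : ℕ :=
  q * R.h n + ∑ i ∈ Finset.Icc 1 q, R.s n i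

theorem offset_succ (R : RankOneConstruction T μ) (n q : ℕ) :
    R.offset n (q + 1) = R.s n (q + 1) + R.h n + R.offset n q := by
  rw [offset, offset, Finset.sum_Icc_succ_top (by omega)]
  ring

theorem offset_add_h_le (R : RankOneConstruction T μ) {n q : ℕ} (hq : q < R.r n) :
    R.offset n q + R.h n ≤ R.h (n + 1) := by
  have hsum : ∑ i ∈ Finset.Icc 1 q, R.s n i ≤ ∑ i ∈ Finset.Icc 1 (R.r n), R.s n i :=
    Finset.sum_le_sum_of_subset (Finset.Icc_subset_Icc_right hq.le)
  have hmul : (q + 1) * R.h n ≤ R.r n * R.h n := Nat.mul_le_mul_right _ hq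
  rw [offset, h_succ]
  linarith

theorem image_Bsub_eq_C (R : RankOneConstruction T μ) {n i j : ℕ} (hi : 1 ≤ i) (hir : i ≤ R.r n)
    (hj : j < R.s n i) : T^[j + R.h n] '' R.Bsub n i = R.C n i (j + 1) := by
  induction j with
  | zero =>
    rw [zero_add]
    exact R.image_Bsub_of_ne n i hi hir (by omega)
  | succ j ih =>
    rw [← R.image_C n i (j + 1) hi hir (by omega) hj, ← ih (by omega), ← image_comp,
      ← Function.iterate_succ', add_right_comm]

theorem image_Bsub (R : RankOneConstruction T μ) {n i : ℕ} (hi : 1 ≤ i) (hir : i < R.r n) :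
    T^[R.s n i + R.h n] '' R.Bsub n i = R.Bsub n (i + 1) := by
  rcases eq_or_ne (R.s n i) 0 with h | h
  · rw [h, zero_add]
    exact R.image_Bsub_of_eq n i hi hir h
  · obtain ⟨j, hj⟩ := Nat.exists_eq_succ_of_ne_zero h
    rw [← R.image_C_last n i hi hir h, hj, Nat.succ_eq_add_one,
      ← R.image_Bsub_eq_C hi hir.le (j := j) (by omega), ← image_comp, ← Function.iterate_succ',
      add_right_comm]

theorem image_offset (R : RankOneConstruction T μ) {n q : ℕ} (hq : q < R.r n) :
    T^[R.offset n q] '' R.B (n + 1) = R.Bsub n (q + 1) := by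
  induction q with
  | zero => simp [offset, R.B_succ]
  | succ q ih =>
    rw [← R.image_Bsub (by omega) hq, ← ih (by omega), ← image_comp, ← Function.iterate_add,
      offset_succ]

theorem B_succ_decomposition (R : RankOneConstruction T μ) (n : ℕ) :
    R.B n = ⋃ q ∈ Finset.range (R.r n), T^[R.offset n q] '' R.B (n + 1) := by
  rw [← R.iUnion_Bsub n]
  ext x
  simp only [mem_iUnion, Finset.mem_range, exists_prop]
  constructor
  · rintro ⟨i, ⟨h1, h2⟩, hx⟩
    refine ⟨i - 1, by omega, ?_⟩
    rw [R.image_offset (by omega), Nat.sub_add_cancel h1]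
    exact hx
  · rintro ⟨q, hq, hx⟩
    rw [R.image_offset hq] at hx
    exact ⟨q + 1, ⟨by omega, by omega⟩, hx⟩

/-- The bound `i + R.h m ≤ R.h n` says that a whole copy of tower `m` fits above level `i`, so that
`a + i` is a level of tower `n` for every `a < R.h m`. -/
theorem exists_B_decomposition (R : RankOneConstruction T μ) {m n : ℕ} (hmn : m ≤ n) :
    ∃ P : Finset ℕ, (∀ i ∈ P, i + R.h m ≤ R.h n) ∧ R.B m = ⋃ i ∈ P, T^[i] '' R.B n := by
  induction n, hmn using Nat.le_induction with
  | base => exact ⟨{0}, by simp, by simp⟩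
  | succ n _ ih =>
    obtain ⟨P, hP, hB⟩ := ih
    refine ⟨(P ×ˢ Finset.range (R.r n)).image fun x => x.1 + R.offset n x.2, ?_, ?_⟩
    · intro i hi
      obtain ⟨x, hx, rfl⟩ := Finset.mem_image.1 hi
      rw [Finset.mem_product, Finset.mem_range] at hx
      have h1 := hP _ hx.1
      have h2 := R.offset_add_h_le hx.2
      omega
    · rw [hB, R.B_succ_decomposition n]
      ext x
      simp only [mem_iUnion, image_iUnion, Finset.mem_image, Finset.mem_product, exists_prop,
        ← image_comp, ← Function.iterate_add, Prod.exists]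
      constructor
      · rintro ⟨i, hi, q, hq, hx⟩
        exact ⟨_, ⟨i, q, ⟨hi, hq⟩, rfl⟩, hx⟩
      · rintro ⟨_, ⟨i, q, ⟨hi, hq⟩, rfl⟩, hx⟩
        exact ⟨i, hi, q, hq, hx⟩

theorem eq_of_mem_level (R : RankOneConstruction T μ) {n i j : ℕ} (hi : i < R.h n)
    (hj : j < R.h n) {x : X} (hxi : x ∈ T^[i] '' R.B n) (hxj : x ∈ T^[j] '' R.B n) : i = j := by
  by_contra hij
  exact disjoint_left.1 (R.disjoint_levels n hi hj hij) hxi hxj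

theorem mem_I (R : RankOneConstruction T μ) {m n i : ℕ} :
    i ∈ R.I m n ↔ i < R.h n ∧ T^[i] '' R.B n ⊆ R.B m := by
  simp [I]

/-- Nonempty bases are needed: an empty level lies in `B m` for every index, and `I m n` would be
too large. -/
theorem B_decomposition (R : RankOneConstruction T μ) (hne : ∀ n, (R.B n).Nonempty) {m n : ℕ}
    (hmn : m ≤ n) :
    (∀ i ∈ R.I m n, i + R.h m ≤ R.h n) ∧ R.B m = ⋃ i ∈ R.I m n, T^[i] '' R.B n := by
  obtain ⟨P, hP, hB⟩ := R.exists_B_decomposition hmn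
  have hm := R.h_pos m
  suffices R.I m n = P by rw [this]; exact ⟨hP, hB⟩
  ext i
  rw [mem_I]
  constructor
  · rintro ⟨hi, hsub⟩
    obtain ⟨x, hx⟩ := (hne n).image T^[i]
    have hxm := hsub hx
    rw [hB, mem_iUnion₂] at hxm
    obtain ⟨j, hj, hxj⟩ := hxm
    have := hP j hj
    rwa [R.eq_of_mem_level hi (by omega) hx hxj]
  · intro hi
    have := hP i hi
    refine ⟨by omega, ?_⟩
    rw [hB]
    exact subset_biUnion_of_mem (u := fun i => T^[i] '' R.B n) hi

/-- The union of the levels of the tower of stage `n`. -/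
def tower (R : RankOneConstruction T μ) (n : ℕ) : Set X :=
  ⋃ k ∈ Finset.range (R.h n), T^[k] '' R.B n

/-- A level of the tower of stage `m` is a union of levels of each later tower. -/
theorem level_decomposition (R : RankOneConstruction T μ) (hne : ∀ n, (R.B n).Nonempty)
    {m n : ℕ} (hmn : m ≤ n) (k : ℕ) :
    T^[k] '' R.B m = ⋃ i ∈ R.I m n, T^[k + i] '' R.B n := by
  conv_lhs => rw [(R.B_decomposition hne hmn).2]
  simp only [image_iUnion, ← image_comp, ← Function.iterate_add]

end RankOneConstruction

/-! ## Measures of the levels -/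

namespace RankOneConstruction

variable {X : Type*} [MeasurableSpace X] {T : X → X} {μ : Measure X}

theorem nullMeasurableSet_level (R : RankOneConstruction T μ) (hT : IsTransformation T μ)
    (n k : ℕ) : NullMeasurableSet (T^[k] '' R.B n) μ :=
  (hT.image_iterate R.dom_conull R.bijOn_dom (R.B_subset_dom n) (R.nullMeasurableSet_B n) k).1

theorem measureReal_level (R : RankOneConstruction T μ) (hT : IsTransformation T μ) (n k : ℕ) :
    μ.real (T^[k] '' R.B n) = μ.real (R.B n) := by
  rw [measureReal_def, measureReal_def,
    (hT.image_iterate R.dom_conull R.bijOn_dom (R.B_subset_dom n) (R.nullMeasurableSet_B n) k).2]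

theorem nullMeasurableSet_tower (R : RankOneConstruction T μ) (hT : IsTransformation T μ)
    (n : ℕ) : NullMeasurableSet (R.tower n) μ :=
  Finset.nullMeasurableSet_biUnion _ fun k _ => R.nullMeasurableSet_level hT n k

theorem I_subset_range (R : RankOneConstruction T μ) (m n : ℕ) :
    R.I m n ⊆ Finset.range (R.h n) :=
  fun _ hi => Finset.mem_range.2 (R.mem_I.1 hi).1

variable [IsProbabilityMeasure μ]

/-- One null base makes all bases null: earlier ones are finite unions of its images, later ones are
subsets. Unions of levels could then not approximate the whole space. -/
theorem measure_B_ne_zero (R : RankOneConstruction T μ) (hT : IsTransformation T μ) (n : ℕ) :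
    μ (R.B n) ≠ 0 := by
  intro h0
  have hnull : ∀ n, μ (R.B n) = 0 → ∀ k, μ (T^[k] '' R.B n) = 0 := fun n h k =>
    (hT.image_iterate R.dom_conull R.bijOn_dom (R.B_subset_dom n) (R.nullMeasurableSet_B n) k).2
      |>.trans h
  have hanti : Antitone R.B := antitone_nat_of_succ_le fun n => by
    rw [R.B_succ, ← R.iUnion_Bsub n]
    exact subset_biUnion_of_mem (u := R.Bsub n)
      (show 1 ∈ Icc 1 (R.r n) from ⟨le_rfl, (R.one_lt_r n).le⟩)
  have hall : ∀ m, μ (R.B m) = 0 := by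
    intro m
    rcases le_total m n with hmn | hnm
    · obtain ⟨P, -, hB⟩ := R.exists_B_decomposition hmn
      rw [hB]
      exact (measure_biUnion_null_iff P.countable_toSet).2 fun i _ => hnull n h0 i
    · exact measure_mono_null (hanti hnm) h0
  obtain ⟨m, J, -, hJ⟩ := R.dense_levels univ nullMeasurableSet_univ 1 one_pos
  have hJ0 : μ (⋃ k ∈ J, T^[k] '' R.B m) = 0 :=
    (measure_biUnion_null_iff J.to_countable).2 fun i _ => hnull m (hall m) i
  have h1 : (univ : Set X) ≤ᵐ[μ] symmDiff univ (⋃ k ∈ J, T^[k] '' R.B m) := by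
    filter_upwards [measure_eq_zero_iff_ae_notMem.1 hJ0] with x hx _
    exact Or.inl ⟨trivial, hx⟩
  have := (measure_mono_ae h1).trans_lt hJ
  simp at this

theorem measureReal_B_pos (R : RankOneConstruction T μ) (hT : IsTransformation T μ) (n : ℕ) :
    0 < μ.real (R.B n) :=
  measureReal_nonneg.lt_of_ne' fun h =>
    R.measure_B_ne_zero hT n ((measureReal_eq_zero_iff).1 h)

theorem nonempty_B (R : RankOneConstruction T μ) (hT : IsTransformation T μ) (n : ℕ) :
    (R.B n).Nonempty :=
  nonempty_of_measure_ne_zero (R.measure_B_ne_zero hT n)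

theorem measureReal_biUnion_levels_inter (R : RankOneConstruction T μ)
    (hT : IsTransformation T μ) {n : ℕ} {P : Finset ℕ} (hP : P ⊆ Finset.range (R.h n)) {E : Set X}
    (hE : NullMeasurableSet E μ) :
    μ.real ((⋃ k ∈ P, T^[k] '' R.B n) ∩ E) = ∑ k ∈ P, μ.real (T^[k] '' R.B n ∩ E) := by
  rw [iUnion₂_inter]
  refine measureReal_biUnion_finset₀ ?_ fun k _ => (R.nullMeasurableSet_level hT n k).inter hE
  intro i hi j hj hij
  refine Disjoint.aedisjoint (Disjoint.mono inter_subset_left inter_subset_left ?_)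
  exact R.disjoint_levels n (Finset.mem_range.1 (hP hi)) (Finset.mem_range.1 (hP hj)) hij

theorem measureReal_B_inter (R : RankOneConstruction T μ) (hT : IsTransformation T μ) {m n : ℕ}
    (hmn : m ≤ n) {E : Set X} (hE : NullMeasurableSet E μ) :
    μ.real (R.B m ∩ E) = ∑ i ∈ R.I m n, μ.real (T^[i] '' R.B n ∩ E) := by
  conv_lhs => rw [(R.B_decomposition (R.nonempty_B hT) hmn).2]
  exact R.measureReal_biUnion_levels_inter hT (R.I_subset_range m n) hE

theorem card_I_mul (R : RankOneConstruction T μ) (hT : IsTransformation T μ) {m n : ℕ}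
    (hmn : m ≤ n) : (R.I m n).card * μ.real (R.B n) = μ.real (R.B m) := by
  have h := R.measureReal_B_inter hT hmn (nullMeasurableSet_univ)
  simp only [inter_univ, R.measureReal_level hT, Finset.sum_const, nsmul_eq_mul] at h
  exact h.symm

theorem card_I_pos (R : RankOneConstruction T μ) (hT : IsTransformation T μ) {m n : ℕ}
    (hmn : m ≤ n) : 0 < (R.I m n).card := by
  rw [Nat.pos_iff_ne_zero]
  intro h
  have := R.card_I_mul hT hmn
  rw [h, Nat.cast_zero, zero_mul] at this
  exact (R.measureReal_B_pos hT m).ne this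

theorem measureReal_tower (R : RankOneConstruction T μ) (hT : IsTransformation T μ) (n : ℕ) :
    μ.real (R.tower n) = R.h n * μ.real (R.B n) := by
  have h := R.measureReal_biUnion_levels_inter hT subset_rfl
    (nullMeasurableSet_univ) (n := n)
  simp only [inter_univ, R.measureReal_level hT, Finset.sum_const, nsmul_eq_mul,
    Finset.card_range] at h
  exact h

theorem measureReal_B_le (R : RankOneConstruction T μ) (hT : IsTransformation T μ) (n : ℕ) :
    μ.real (R.B n) ≤ 1 / R.h n := by
  rw [le_div_iff₀ (by exact_mod_cast R.h_pos n), mul_comm, ← R.measureReal_tower hT]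
  exact measureReal_le_one

/-- Every measurable set is well approximated by unions of levels of all sufficiently late
towers. -/
theorem eventually_dense_levels (R : RankOneConstruction T μ) (hT : IsTransformation T μ)
    {A : Set X} (hA : NullMeasurableSet A μ) {ε : ℝ} (hε : 0 < ε) :
    ∃ N, ∀ n, N ≤ n → ∃ P : Finset ℕ, P ⊆ Finset.range (R.h n) ∧
      μ.real (symmDiff A (⋃ k ∈ P, T^[k] '' R.B n)) < ε := by
  obtain ⟨N, J, hJ, hAJ⟩ := R.dense_levels A hA ε hε
  refine ⟨N, fun n hn => ?_⟩
  have hfin : J.Finite := (finite_Iio _).subset hJ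
  -- The approximating set stays the same; only its levels are cut into levels of stage `n`.
  refine ⟨(hfin.toFinset ×ˢ R.I N n).image fun x => x.1 + x.2, ?_, ?_⟩
  · intro i hi
    obtain ⟨x, hx, rfl⟩ := Finset.mem_image.1 hi
    rw [Finset.mem_product, Finite.mem_toFinset] at hx
    have h1 := (R.B_decomposition (R.nonempty_B hT) hn).1 _ hx.2
    have h2 : x.1 < R.h N := hJ hx.1
    exact Finset.mem_range.2 (by omega)
  · have : (⋃ k ∈ (hfin.toFinset ×ˢ R.I N n).image fun x => x.1 + x.2, T^[k] '' R.B n) =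
        ⋃ k ∈ J, T^[k] '' R.B N := by
      ext x
      simp only [R.level_decomposition (R.nonempty_B hT) hn, mem_iUnion, Finset.mem_image,
        Finset.mem_product, Finite.mem_toFinset, exists_prop, Prod.exists]
      constructor
      · rintro ⟨_, ⟨i, q, ⟨hi, hq⟩, rfl⟩, hx⟩
        exact ⟨i, hi, q, hq, hx⟩
      · rintro ⟨i, hi, q, hq, hx⟩
        exact ⟨_, ⟨i, q, ⟨hi, hq⟩, rfl⟩, hx⟩
    rw [this, measureReal_def]
    exact (ENNReal.lt_ofReal_iff_toReal_lt (measure_ne_top _ _)).1 hAJ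

theorem eventually_measureReal_compl_tower_lt (R : RankOneConstruction T μ)
    (hT : IsTransformation T μ) {ε : ℝ} (hε : 0 < ε) :
    ∃ N, ∀ n, N ≤ n → μ.real (R.tower n)ᶜ < ε := by
  obtain ⟨N, hN⟩ := R.eventually_dense_levels hT (A := univ) nullMeasurableSet_univ hε
  refine ⟨N, fun n hn => ?_⟩
  obtain ⟨P, hP, hlt⟩ := hN n hn
  refine (measureReal_mono ?_).trans_lt hlt
  intro x hx
  refine Or.inl ⟨trivial, fun hxP => hx ?_⟩
  exact biUnion_subset_biUnion_left (t := fun k => T^[k] '' R.B n) hP hxP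

end RankOneConstruction

/-! ## From a finite cyclic factor to the counting condition -/

theorem ae_iterate_add {X : Type*} [MeasurableSpace X] {T : X → X} {μ : Measure X}
    (hT : IsMeasurePreservingMap T μ μ) {k : ℕ} {φ : X → ZMod k}
    (hφ : ∀ᵐ x ∂μ, φ (T x) = φ x + 1) (i : ℕ) : ∀ᵐ x ∂μ, φ (T^[i] x) = φ x + i := by
  induction i with
  | zero => simp
  | succ i ih =>
    filter_upwards [hT.ae_comp ih, hφ] with x h1 h2
    rw [Function.iterate_succ_apply, h1, h2]
    push_cast
    ring

theorem card_filter_natCast_eq_ge {k : ℕ} [NeZero k] (h : ℕ) (c : ZMod k) :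
    h / k ≤ ((Finset.range h).filter fun i : ℕ => (i : ZMod k) = c).card := by
  conv_lhs => rw [← Finset.card_range (h / k)]
  refine Finset.card_le_card_of_injOn (fun t => t * k + c.val) ?_ ?_
  · intro t ht
    have ht' : t + 1 ≤ h / k := Finset.mem_range.1 ht
    have h1 : (t + 1) * k ≤ h := (Nat.mul_le_mul_right k ht').trans (Nat.div_mul_le_self h k)
    have h2 := ZMod.val_lt c
    refine Finset.mem_coe.2 (Finset.mem_filter.2 ⟨Finset.mem_range.2 ?_, ?_⟩)
    · rw [add_mul, one_mul] at h1
      exact (Nat.add_lt_add_left h2 _).trans_le h1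
    · simp
  · intro t _ t' _ htt
    simpa [NeZero.ne k] using htt

namespace RankOneConstruction

variable {X : Type*} [MeasurableSpace X] {T : X → X} {μ : Measure X}

theorem measureReal_level_inter_fiber (R : RankOneConstruction T μ) (hT : IsTransformation T μ)
    {k : ℕ} {φ : X → ZMod k} (hφm : ∀ c, NullMeasurableSet (φ ⁻¹' {c}) μ)
    (hφ : ∀ᵐ x ∂μ, φ (T x) = φ x + 1) (n i : ℕ) (c : ZMod k) :
    μ.real (T^[i] '' R.B n ∩ φ ⁻¹' {c}) = μ.real (R.B n ∩ φ ⁻¹' {c - i}) := by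
  rw [measureReal_def, hT.measure_image_iterate_inter R.dom_conull R.bijOn_dom (R.B_subset_dom n)
    (R.nullMeasurableSet_B n) (hφm c), measureReal_def]
  congr 1
  refine measure_congr ?_
  filter_upwards [ae_iterate_add hT.1 hφ i] with x hx
  refine propext (and_congr_right fun _ => ?_)
  change φ (T^[i] x) = c ↔ φ x = c - i
  rw [hx, eq_sub_iff_add_eq]

variable [IsProbabilityMeasure μ]

theorem sum_measureReal_B_inter_fiber (R : RankOneConstruction T μ) {k : ℕ} [NeZero k]
    {φ : X → ZMod k} (hφm : ∀ c, NullMeasurableSet (φ ⁻¹' {c}) μ) (n : ℕ) :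
    ∑ c, μ.real (R.B n ∩ φ ⁻¹' {c}) = μ.real (R.B n) := by
  rw [← measureReal_biUnion_finset₀]
  · congr 1
    ext x
    simp
  · intro c _ d _ hcd
    refine Disjoint.aedisjoint (Disjoint.mono inter_subset_right inter_subset_right ?_)
    exact disjoint_left.2 fun x hx hx' => hcd (hx.symm.trans hx')
  · exact fun c _ => (R.nullMeasurableSet_B n).inter (hφm c)

/-- A factor map to a finite cyclic permutation is almost constant on the base of each
sufficiently late tower. -/
theorem eventually_concentrated (R : RankOneConstruction T μ) (hT : IsTransformation T μ)
    {k : ℕ} [NeZero k] {φ : X → ZMod k} (hφm : ∀ c, NullMeasurableSet (φ ⁻¹' {c}) μ)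
    (hφ : ∀ᵐ x ∂μ, φ (T x) = φ x + 1) {δ : ℝ} (hδ : 0 < δ) :
    ∃ N, ∀ m, N ≤ m → ∃ c,
      μ.real (R.B m) - μ.real (R.B m ∩ φ ⁻¹' {c}) ≤ δ * μ.real (R.B m) := by
  have hk : (0 : ℝ) < k := by exact_mod_cast Nat.pos_of_ne_zero (NeZero.ne k)
  -- The bound `1 / (2 * k)` will exclude the small alternative for a fiber holding at least `1/k`
  -- of the base.
  obtain ⟨δ', hδ', hδδ, hδk⟩ : ∃ δ' : ℝ, 0 < δ' ∧ δ' ≤ δ ∧ δ' ≤ 1 / (2 * k) :=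
    ⟨min δ (1 / (2 * k)), lt_min hδ (by positivity), min_le_left _ _, min_le_right _ _⟩
  obtain ⟨N₁, hN₁⟩ := R.eventually_dense_levels hT (hφm 0) (ε := δ' / (4 * k)) (by positivity)
  obtain ⟨N₂, hN₂⟩ := R.eventually_measureReal_compl_tower_lt hT (ε := 1 / 2) (by norm_num)
  -- Taking `m ≥ k` ensures `k ≤ 2 ^ m ≤ R.h m`, so each residue class occurs among the levels.
  refine ⟨max (max N₁ N₂) k, fun m hm => ?_⟩
  obtain ⟨P, hP, hlt⟩ := hN₁ m (by omega)
  have htower : 1 / 2 < R.h m * μ.real (R.B m) := by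
    have h1 := hN₂ m (by omega)
    rw [probReal_compl_eq_one_sub₀ (R.nullMeasurableSet_tower hT m), R.measureReal_tower hT] at h1
    linarith
  have hhk : k ≤ R.h m :=
    (show k ≤ m by omega).trans (Nat.lt_two_pow_self.le.trans (R.two_pow_le_h m))
  set b := μ.real (R.B m) with hb
  have hbpos : 0 < b := R.measureReal_B_pos hT m
  set q : ZMod k → ℝ := fun c => μ.real (R.B m ∩ φ ⁻¹' {c}) with hq
  have hq0 : ∀ c, 0 ≤ q c := fun c => measureReal_nonneg
  have hqb : ∀ c, q c ≤ b := fun c => measureReal_mono inter_subset_left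
  set E := symmDiff (φ ⁻¹' {0}) (⋃ k ∈ P, T^[k] '' R.B m) with hE
  have hEm : NullMeasurableSet E μ := (hφm 0).symmDiff
    (Finset.nullMeasurableSet_biUnion _ fun i _ => R.nullMeasurableSet_level hT m i)
  -- A level chosen in `P` errs on its part outside the fiber, a level not chosen on its part
  -- inside.
  have hlevel : ∀ i ∈ Finset.range (R.h m),
      min (q (-i)) (b - q (-i)) ≤ μ.real (T^[i] '' R.B m ∩ E) := by
    intro i hi
    have hqi : μ.real (T^[i] '' R.B m ∩ φ ⁻¹' {0}) = q (-i) := by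
      rw [R.measureReal_level_inter_fiber hT hφm hφ, zero_sub]
    by_cases hiP : i ∈ P
    · refine (min_le_right _ _).trans ?_
      have h1 : b - q (-i) = μ.real (T^[i] '' R.B m \ φ ⁻¹' {0}) := by
        rw [← hqi, hb, ← R.measureReal_level hT m i,
          ← measureReal_inter_add_sdiff₀ (s := T^[i] '' R.B m) (hφm 0)]
        ring
      rw [h1]
      refine measureReal_mono fun x hx => ⟨hx.1, Or.inr ⟨?_, hx.2⟩⟩
      exact mem_biUnion (t := fun k => T^[k] '' R.B m) hiP hx.1
    · refine (min_le_left _ _).trans ?_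
      rw [← hqi]
      refine measureReal_mono fun x hx => ⟨hx.1, Or.inl ⟨hx.2, ?_⟩⟩
      intro hxP
      obtain ⟨j, hj, hxj⟩ := mem_iUnion₂.1 hxP
      have := R.eq_of_mem_level (Finset.mem_range.1 hi) (Finset.mem_range.1 (hP hj)) hx.1 hxj
      exact hiP (this ▸ hj)
  have hmin : ∀ c, min (q c) (b - q c) < δ' * b := by
    intro c
    have hnn : ∀ c, 0 ≤ min (q c) (b - q c) := fun c => le_min (hq0 c) (sub_nonneg.2 (hqb c))
    have h1 : ((R.h m / k : ℕ) : ℝ) * min (q c) (b - q c) < δ' / (4 * k) := by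
      calc ((R.h m / k : ℕ) : ℝ) * min (q c) (b - q c)
          ≤ ((Finset.range (R.h m)).filter fun i : ℕ => (i : ZMod k) = -c).card *
              min (q c) (b - q c) := by
            gcongr
            · exact hnn c
            · exact card_filter_natCast_eq_ge _ _
        _ = ∑ i ∈ (Finset.range (R.h m)).filter fun i : ℕ => (i : ZMod k) = -c,
              min (q (-i)) (b - q (-i)) := by
            rw [← nsmul_eq_mul, ← Finset.sum_const]
            refine Finset.sum_congr rfl fun i hi => ?_
            rw [(Finset.mem_filter.1 hi).2, neg_neg]
        _ ≤ ∑ i ∈ Finset.range (R.h m), min (q (-i)) (b - q (-i)) :=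
            Finset.sum_le_sum_of_subset_of_nonneg (Finset.filter_subset _ _)
              fun i _ _ => hnn _
        _ ≤ ∑ i ∈ Finset.range (R.h m), μ.real (T^[i] '' R.B m ∩ E) := Finset.sum_le_sum hlevel
        _ = μ.real (R.tower m ∩ E) := (R.measureReal_biUnion_levels_inter hT subset_rfl hEm).symm
        _ ≤ μ.real E := measureReal_mono inter_subset_right
        _ < δ' / (4 * k) := hlt
    -- Rounding down loses at most a factor 2. With the tower of measure above `1/2`, this accounts
    -- for the 4 in `δ' / (4 * k)`.
    have h2 : (R.h m : ℝ) ≤ 2 * k * (R.h m / k : ℕ) := by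
      have h3 := Nat.div_add_mod (R.h m) k
      have h4 := Nat.mod_lt (R.h m) (Nat.pos_of_ne_zero (NeZero.ne k))
      have h5 : 1 ≤ R.h m / k := (Nat.one_le_div_iff (Nat.pos_of_ne_zero (NeZero.ne k))).2 hhk
      have h6 : k * 1 ≤ k * (R.h m / k) := Nat.mul_le_mul_left k h5
      have h7 : R.h m ≤ 2 * (k * (R.h m / k)) := by omega
      rw [mul_assoc]
      exact_mod_cast h7
    have h3 : R.h m * min (q c) (b - q c) < δ' / 2 := by
      rw [lt_div_iff₀ (by positivity)] at h1
      nlinarith [mul_le_mul_of_nonneg_right h2 (hnn c)]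
    have hh : (0 : ℝ) < R.h m := by exact_mod_cast R.h_pos m
    refine lt_of_mul_lt_mul_left (a := (R.h m : ℝ)) ?_ hh.le
    nlinarith [mul_lt_mul_of_pos_left htower hδ']
  obtain ⟨c, -, hc⟩ : ∃ c ∈ (Finset.univ : Finset (ZMod k)), b / k ≤ q c := by
    refine Finset.exists_le_of_sum_le Finset.univ_nonempty ?_
    rw [R.sum_measureReal_B_inter_fiber hφm, Finset.sum_const, Finset.card_univ, ZMod.card,
      nsmul_eq_mul, mul_div_cancel₀ _ hk.ne']
  refine ⟨c, ?_⟩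
  have hδb : δ' * b ≤ δ * b := by gcongr
  rcases min_lt_iff.1 (hmin c) with h | h
  · exfalso
    have h1 : δ' * b ≤ 1 / (2 * k) * b := by gcongr
    have h2 : 1 / (2 * k) * b = b / k / 2 := by field_simp
    have h3 : 0 < b / k := by positivity
    linarith
  · exact h.le.trans hδb

theorem countingCondition_of_equivariant (R : RankOneConstruction T μ) (hT : IsTransformation T μ)
    {k : ℕ} [NeZero k] {φ : X → ZMod k} (hφm : ∀ c, NullMeasurableSet (φ ⁻¹' {c}) μ)
    (hφ : ∀ᵐ x ∂μ, φ (T x) = φ x + 1) : R.CountingCondition k := by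
  intro η hη
  -- Chosen so that `δ / (1 - δ) = η / 2`, and the final bound is `δ / (1 - δ)`.
  set δ := η / (2 + η) with hδ
  have hδ0 : 0 < δ := by positivity
  have hδ1 : 1 - δ = 2 / (2 + η) := by rw [hδ]; field_simp; ring
  have hδpos : 0 < 1 - δ := by rw [hδ1]; positivity
  obtain ⟨N, hN⟩ := R.eventually_concentrated hT hφm hφ hδ0
  refine ⟨N, fun m n hm hmn => ?_⟩
  obtain ⟨c, hc⟩ := hN m hm
  obtain ⟨d, hd⟩ := hN n (hm.trans hmn)
  refine ⟨c - d, ?_⟩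
  have hbn := R.measureReal_B_pos hT n
  have hI : (0 : ℝ) < (R.I m n).card := by exact_mod_cast R.card_I_pos hT hmn
  have hsplit : ∀ A : Set X, μ.real (A ∩ (φ ⁻¹' {c})ᶜ) = μ.real A - μ.real (A ∩ φ ⁻¹' {c}) := by
    intro A
    rw [← measureReal_inter_add_sdiff₀ (s := A) (hφm c), sdiff_eq]
    ring
  have hterm : ∀ i ∈ (R.I m n).filter fun i : ℕ => (i : ZMod k) ≠ c - d,
      (1 - δ) * μ.real (R.B n) ≤ μ.real (T^[i] '' R.B n ∩ (φ ⁻¹' {c})ᶜ) := by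
    intro i hi
    have hne : c - i ≠ d := fun h => (Finset.mem_filter.1 hi).2 (by rw [← h]; ring)
    rw [hsplit, R.measureReal_level hT, R.measureReal_level_inter_fiber hT hφm hφ]
    -- The fibers over `c - i` and `d` are disjoint and the second fills all but `δ` of `B n`, so
    -- the first gets at most `δ`.
    have hpair : ∑ e ∈ {c - i, d}, μ.real (R.B n ∩ φ ⁻¹' {e}) ≤ μ.real (R.B n) := by
      rw [← R.sum_measureReal_B_inter_fiber hφm n]
      exact Finset.sum_le_sum_of_subset_of_nonneg (Finset.subset_univ _)
        fun _ _ _ => measureReal_nonneg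
    rw [Finset.sum_pair hne] at hpair
    linarith
  have hsum : ((R.I m n).filter fun i : ℕ => (i : ZMod k) ≠ c - d).card *
      ((1 - δ) * μ.real (R.B n)) ≤ δ * ((R.I m n).card * μ.real (R.B n)) := by
    rw [R.card_I_mul hT hmn]
    refine le_trans ?_ hc
    rw [← hsplit, R.measureReal_B_inter hT hmn (hφm c).compl, ← nsmul_eq_mul]
    refine (Finset.card_nsmul_le_sum _ _ _ hterm).trans ?_
    exact Finset.sum_le_sum_of_subset_of_nonneg (Finset.filter_subset _ _)
      fun _ _ _ => measureReal_nonneg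
  rw [div_lt_iff₀ hI]
  have h1 : ((R.I m n).filter fun i : ℕ => (i : ZMod k) ≠ c - d).card * (1 - δ) ≤
      δ * (R.I m n).card := by
    refine le_of_mul_le_mul_right ?_ hbn
    linarith
  have h2 : δ < η * (1 - δ) := by
    rw [hδ1, hδ, mul_div_assoc', div_lt_div_iff_of_pos_right (by positivity)]
    linarith
  refine lt_of_mul_lt_mul_right ?_ hδpos.le
  nlinarith [mul_lt_mul_of_pos_right h2 hI]

theorem countingCondition_of_factorsOnto (R : RankOneConstruction T μ)
    (hT : IsTransformation T μ) {k : ℕ} (hk : 1 < k)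
    (h : FactorsOnto T μ (cyclicMap k) (cyclicMeasure k)) : R.CountingCondition k := by
  have : NeZero k := ⟨by omega⟩
  obtain ⟨φ, hφ, heq, -⟩ := h
  exact R.countingCondition_of_equivariant hT
    (fun c => hφ.nullMeasurable (measurableSet_singleton c)) heq

end RankOneConstruction

/-! ## From the counting condition to an odometer factor -/

namespace RankOneConstruction

variable {X : Type*} [MeasurableSpace X] {T : X → X} {μ : Measure X}

/-- The index of the level of the tower of stage `n` that contains `x`, and `0` off the tower. -/
def levelIndex (R : RankOneConstruction T μ) (n : ℕ) (x : X) : ℤ :=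
  ∑ a ∈ Finset.range (R.h n), (T^[a] '' R.B n).indicator (fun _ => (a : ℤ)) x

theorem levelIndex_eq (R : RankOneConstruction T μ) {n a : ℕ} (ha : a < R.h n) {x : X}
    (hx : x ∈ T^[a] '' R.B n) : R.levelIndex n x = a := by
  rw [levelIndex, Finset.sum_eq_single_of_mem a (Finset.mem_range.2 ha), indicator_of_mem hx]
  intro b hb hba
  exact indicator_of_notMem
    (fun hxb => hba (R.eq_of_mem_level (Finset.mem_range.1 hb) ha hxb hx)) _

theorem nullMeasurable_levelIndex (R : RankOneConstruction T μ) (hT : IsTransformation T μ)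
    (n : ℕ) : NullMeasurable (R.levelIndex n) μ := by
  -- Null measurability is measurability for the completed sigma-algebra.
  have h : @Measurable (NullMeasurableSpace X μ) ℤ _ _ (R.levelIndex n) :=
    Finset.measurable_sum _ fun a _ =>
      (measurable_const (β := NullMeasurableSpace X μ)).indicator
        (R.nullMeasurableSet_level hT n a)
  exact h

theorem levelIndex_ne_subset (R : RankOneConstruction T μ) (n : ℕ) :
    {x | R.levelIndex n (T x) ≠ R.levelIndex n x + 1} ⊆
      (R.tower n)ᶜ ∪ T^[R.h n - 1] '' R.B n := by
  intro x hx
  by_contra hcon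
  rw [mem_union, not_or, notMem_compl_iff] at hcon
  obtain ⟨htower, htop⟩ := hcon
  obtain ⟨a, ha, hxa⟩ := mem_iUnion₂.1 htower
  have ha' : a < R.h n := Finset.mem_range.1 ha
  have hne : a ≠ R.h n - 1 := by
    rintro rfl
    exact htop hxa
  refine hx ?_
  have hTx : T x ∈ T^[a + 1] '' R.B n := by
    obtain ⟨y, hy, rfl⟩ := hxa
    exact ⟨y, hy, Function.iterate_succ_apply' T a y⟩
  rw [R.levelIndex_eq ha' hxa, R.levelIndex_eq (by omega) hTx]
  push_cast
  rfl

variable [IsProbabilityMeasure μ]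

theorem measureReal_levelIndex_ne_le (R : RankOneConstruction T μ) (hT : IsTransformation T μ)
    (n : ℕ) : μ.real {x | R.levelIndex n (T x) ≠ R.levelIndex n x + 1} ≤
      μ.real (R.tower n)ᶜ + 1 / 2 ^ n := by
  refine (measureReal_mono (R.levelIndex_ne_subset n)).trans ((measureReal_union_le _ _).trans ?_)
  rw [R.measureReal_level hT]
  gcongr
  refine (R.measureReal_B_le hT n).trans ?_
  gcongr
  exact_mod_cast R.two_pow_le_h n

/-- A point of level `a` of tower `m` lies in level `a + i` of tower `n` for some `i ∈ I m n`. The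
copies with `i ≢ j` fill a share below `η` of tower `m`. -/
theorem measureReal_levelIndex_sub_ne_le (R : RankOneConstruction T μ) (hT : IsTransformation T μ)
    {k m n : ℕ} (hmn : m ≤ n) {η : ℝ} {j : ZMod k}
    (hj : (((R.I m n).filter fun i : ℕ => (i : ZMod k) ≠ j).card : ℝ) /
      ((R.I m n).card : ℝ) < η) :
    μ.real {x | (R.levelIndex n x : ZMod k) ≠ R.levelIndex m x + j} ≤
      μ.real (R.tower m)ᶜ + η := by
  have hI : (0 : ℝ) < (R.I m n).card := by exact_mod_cast R.card_I_pos hT hmn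
  have hη : 0 ≤ η := le_trans (by positivity) hj.le
  rw [div_lt_iff₀ hI] at hj
  set F := (R.I m n).filter fun i : ℕ => (i : ZMod k) ≠ j with hF
  have hsub : {x | (R.levelIndex n x : ZMod k) ≠ R.levelIndex m x + j} ⊆
      (R.tower m)ᶜ ∪ ⋃ a ∈ Finset.range (R.h m), ⋃ i ∈ F, T^[a + i] '' R.B n := by
    intro x hx
    by_cases hxt : x ∈ R.tower m
    · right
      obtain ⟨a, ha, hxa⟩ := mem_iUnion₂.1 hxt
      have hxa' := hxa
      rw [R.level_decomposition (R.nonempty_B hT) hmn] at hxa'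
      obtain ⟨i, hi, hxi⟩ := mem_iUnion₂.1 hxa'
      have ha' := Finset.mem_range.1 ha
      have hin := (R.B_decomposition (R.nonempty_B hT) hmn).1 i hi
      refine mem_iUnion₂.2 ⟨a, ha, mem_iUnion₂.2 ⟨i, Finset.mem_filter.2 ⟨hi, ?_⟩, hxi⟩⟩
      rintro rfl
      refine hx ?_
      rw [R.levelIndex_eq ha' hxa, R.levelIndex_eq (by omega) hxi]
      push_cast
      rfl
    · exact Or.inl hxt
  refine (measureReal_mono hsub).trans ((measureReal_union_le _ _).trans ?_)
  gcongr
  calc μ.real (⋃ a ∈ Finset.range (R.h m), ⋃ i ∈ F, T^[a + i] '' R.B n)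
      ≤ ∑ a ∈ Finset.range (R.h m), ∑ i ∈ F, μ.real (T^[a + i] '' R.B n) :=
        (measureReal_biUnion_finset_le _ _).trans
          (Finset.sum_le_sum fun a _ => measureReal_biUnion_finset_le _ _)
    _ = R.h m * (F.card * μ.real (R.B n)) := by
        simp only [R.measureReal_level hT, Finset.sum_const, nsmul_eq_mul, Finset.card_range]
    _ ≤ R.h m * (η * (R.I m n).card * μ.real (R.B n)) := by gcongr
    _ = η * μ.real (R.tower m) := by
        rw [R.measureReal_tower hT, ← R.card_I_mul hT hmn]
        ring
    _ ≤ η := mul_le_of_le_one_right hη measureReal_le_one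

/-- The counting condition for a divisibility chain yields integer-valued functions that converge
almost everywhere in the odometer, and asymptotically intertwine `T` with the addition of `1`. -/
theorem exists_approximate_factor (R : RankOneConstruction T μ) (hT : IsTransformation T μ)
    (K : OdometerScale) (hK : ∀ l, R.CountingCondition (K.k l)) :
    ∃ ψ : ℕ → X → ℤ, (∀ l, NullMeasurable (ψ l) μ) ∧
      (∀ᵐ x ∂μ, ∀ᶠ l in Filter.atTop, (ψ (l + 1) x : ZMod (K.k l)) = ψ l x) ∧
      (∀ᵐ x ∂μ, ∀ᶠ l in Filter.atTop, ψ l (T x) = ψ l x + 1) := by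
  have hpos : ∀ l : ℕ, (0 : ℝ) < (1 / 2) ^ l := fun l => by positivity
  choose N₁ hN₁ using fun l => hK l _ (hpos l)
  choose N₂ hN₂ using fun l => R.eventually_measureReal_compl_tower_lt hT (hpos l)
  -- Partial sums make the stages monotone and beyond all thresholds; the `+ 1` gives `l ≤ M l`,
  -- hence summable top levels.
  set M : ℕ → ℕ := fun l => ∑ i ∈ Finset.range (l + 1), (N₁ i + N₂ i + 1) with hM
  have hMsucc : ∀ l, M l ≤ M (l + 1) := fun l => by
    simp only [hM]
    rw [Finset.sum_range_succ _ (l + 1)]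
    exact Nat.le_add_right _ _
  have hMN : ∀ l, N₁ l + N₂ l ≤ M l := fun l => by
    simp only [hM]
    rw [Finset.sum_range_succ _ l]
    omega
  have hMl : ∀ l, l ≤ M l := fun l => by
    have : ∑ i ∈ Finset.range (l + 1), 1 ≤ M l := Finset.sum_le_sum fun i _ => by omega
    simp only [Finset.sum_const, Finset.card_range, smul_eq_mul, mul_one] at this
    omega
  choose j hj using fun l => hN₁ l (M l) (M (l + 1)) (by have := hMN l; omega) (hMsucc l)
  -- Integer lifts, since the accumulated shifts are reduced modulo every term of the scale.
  choose J hJ using fun l => ZMod.intCast_surjective (j l)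
  have htower : ∀ l, μ.real (R.tower (M l))ᶜ ≤ (1 / 2) ^ l := fun l =>
    (hN₂ l (M l) (by have := hMN l; omega)).le
  have hsummable : ∑' l : ℕ, ENNReal.ofReal (2 * (1 / 2) ^ l) ≠ ⊤ :=
    (summable_geometric_two.mul_left 2).tsum_ofReal_ne_top
  have hBC : ∀ D : ℕ → Set X, (∀ l, μ.real (D l) ≤ 2 * (1 / 2) ^ l) →
      ∀ᵐ x ∂μ, ∀ᶠ l in Filter.atTop, x ∉ D l := fun D hD =>
    ae_eventually_notMem (ne_top_of_le_ne_top hsummable (ENNReal.tsum_le_tsum fun l => by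
      rw [← ofReal_measureReal]
      exact ENNReal.ofReal_le_ofReal (hD l)))
  refine ⟨fun l x => R.levelIndex (M l) x - ∑ i ∈ Finset.range l, J i, ?_, ?_, ?_⟩
  · intro l
    exact (measurable_id.sub_const _).comp_nullMeasurable (R.nullMeasurable_levelIndex hT (M l))
  · filter_upwards [hBC _ fun l => (R.measureReal_levelIndex_sub_ne_le hT (hMsucc l) (hj l)).trans
      (by have := htower l; linarith)] with x hx
    filter_upwards [hx] with l hl
    rw [not_not] at hl
    rw [Finset.sum_range_succ]
    push_cast
    rw [hl, hJ]
    ring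
  · filter_upwards [hBC _ fun l => (R.measureReal_levelIndex_ne_le hT (M l)).trans (by
      have h1 := htower l
      have h2 : (1 : ℝ) / 2 ^ M l ≤ (1 / 2) ^ l := by
        rw [one_div_pow]
        exact one_div_le_one_div_of_le (by positivity) (pow_le_pow_right₀ (by norm_num) (hMl l))
      linarith)] with x hx
    filter_upwards [hx] with l hl
    rw [not_not] at hl
    rw [hl]
    ring

/-! ### Least common multiples -/

/-- Each exceptional set is less than half of `I m n`, so some `i₀` is good for both moduli. It
serves as the residue mod the lcm, since all indices good for both agree with it mod `k` and mod
`l`. -/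
theorem CountingCondition.lcm {R : RankOneConstruction T μ} (hT : IsTransformation T μ) {k l : ℕ}
    (hk : R.CountingCondition k) (hl : R.CountingCondition l) :
    R.CountingCondition (Nat.lcm k l) := by
  intro η hη
  have hη' : 0 < min (η / 2) (1 / 2) := by positivity
  obtain ⟨N₁, hN₁⟩ := hk _ hη'
  obtain ⟨N₂, hN₂⟩ := hl _ hη'
  refine ⟨max N₁ N₂, fun m n hm hmn => ?_⟩
  obtain ⟨a, ha⟩ := hN₁ m n (by omega) hmn
  obtain ⟨b, hb⟩ := hN₂ m n (by omega) hmn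
  have hI : (0 : ℝ) < (R.I m n).card := by exact_mod_cast R.card_I_pos hT hmn
  rw [div_lt_iff₀ hI] at ha hb
  set F := (R.I m n).filter fun i : ℕ => (i : ZMod k) ≠ a with hF
  set G := (R.I m n).filter fun i : ℕ => (i : ZMod l) ≠ b with hG
  have hunion : ((F ∪ G).card : ℝ) ≤ F.card + G.card := by
    exact_mod_cast Finset.card_union_le F G
  have h1 := mul_le_mul_of_nonneg_right (min_le_left (η / 2) (1 / 2)) hI.le
  have h2 := mul_le_mul_of_nonneg_right (min_le_right (η / 2) (1 / 2)) hI.le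
  have hcard : (F ∪ G).card < (R.I m n).card := by
    have : ((F ∪ G).card : ℝ) < (R.I m n).card := by linarith
    exact_mod_cast this
  obtain ⟨i₀, hi₀, hi₀FG⟩ := Finset.exists_mem_notMem_of_card_lt_card hcard
  have hnot : ∀ i ∈ R.I m n, i ∉ F ∪ G → (i : ZMod k) = a ∧ (i : ZMod l) = b := by
    intro i hi hiFG
    rw [Finset.mem_union, hF, hG, Finset.mem_filter, Finset.mem_filter] at hiFG
    tauto
  refine ⟨i₀, ?_⟩
  rw [div_lt_iff₀ hI]
  have hsub : ((R.I m n).filter fun i : ℕ => (i : ZMod (Nat.lcm k l)) ≠ i₀) ⊆ F ∪ G := by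
    intro i hi
    rw [Finset.mem_filter] at hi
    by_contra hiFG
    refine hi.2 ?_
    obtain ⟨hia, hib⟩ := hnot i hi.1 hiFG
    obtain ⟨hi₀a, hi₀b⟩ := hnot i₀ hi₀ hi₀FG
    have hk' : (k : ℤ) ∣ i - i₀ := by
      rw [← ZMod.intCast_zmod_eq_zero_iff_dvd]
      push_cast
      rw [hia, hi₀a, sub_self]
    have hl' : (l : ℤ) ∣ i - i₀ := by
      rw [← ZMod.intCast_zmod_eq_zero_iff_dvd]
      push_cast
      rw [hib, hi₀b, sub_self]
    have hkl : ((Nat.lcm k l : ℕ) : ℤ) ∣ i - i₀ := by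
      have := Int.coe_lcm_dvd hk' hl'
      simpa using this
    rw [← ZMod.intCast_zmod_eq_zero_iff_dvd] at hkl
    push_cast at hkl
    exact sub_eq_zero.1 hkl
  have hle : (((R.I m n).filter fun i : ℕ => (i : ZMod (Nat.lcm k l)) ≠ i₀).card : ℝ) ≤
      (F ∪ G).card := by exact_mod_cast Finset.card_le_card hsub
  linarith

theorem exists_scale_of_countingCondition (R : RankOneConstruction T μ)
    (hT : IsTransformation T μ)
    (h : ∀ M : ℕ, ∃ k : ℕ, M ≤ k ∧ 1 < k ∧ R.CountingCondition k) :
    ∃ K : OdometerScale, ∀ l, R.CountingCondition (K.k l) := by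
  choose g hg hg1 hgc using h
  set f : ℕ → ℕ := fun n => n.rec (g 0) fun n p => Nat.lcm p (g n) with hf
  have hsucc : ∀ n, f (n + 1) = Nat.lcm (f n) (g n) := fun n => rfl
  have h1 : ∀ n, 1 < f n := fun n => by
    induction n with
    | zero => exact hg1 0
    | succ n ih =>
      rw [hsucc]
      exact ih.trans_le (Nat.le_of_dvd (Nat.lcm_pos (by omega) (by have := hg1 n; omega))
        (Nat.dvd_lcm_left _ _))
  -- `f (M + 1)` is a multiple of `g M`, which is at least `M`.
  refine ⟨⟨f, h1, fun n => Nat.dvd_lcm_left _ _, fun M => ⟨M + 1, (hg M).trans ?_⟩⟩, fun n => ?_⟩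
  · exact Nat.le_of_dvd (by have := h1 (M + 1); omega) (Nat.dvd_lcm_right _ _)
  · change R.CountingCondition (f n)
    induction n with
    | zero => exact hgc 0
    | succ n ih => exact ih.lcm hT (hgc n)

end RankOneConstruction

/-! ## Recognizing factors onto finite cyclic permutations and odometers -/

section Cyclic

variable {X : Type*} [MeasurableSpace X] {T : X → X} {μ : Measure X} [IsProbabilityMeasure μ]

/-- `T` pulls each fiber back to the preceding one, so invariance of `μ` gives all `k` fibers the
same mass. -/
theorem measure_fiber_of_equivariant (hT : IsMeasurePreservingMap T μ μ) {k : ℕ} [NeZero k]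
    {g : X → ZMod k} (hgm : ∀ c, NullMeasurableSet (g ⁻¹' {c}) μ)
    (hg : ∀ᵐ x ∂μ, g (T x) = g x + 1) (c : ZMod k) : μ (g ⁻¹' {c}) = (k : ENNReal)⁻¹ := by
  have hstep : ∀ c, μ (g ⁻¹' {c + 1}) = μ (g ⁻¹' {c}) := fun c => by
    rw [← hT.measure_preimage₀ (hgm (c + 1))]
    refine measure_congr ?_
    filter_upwards [hg] with x hx
    refine propext ?_
    change g (T x) = c + 1 ↔ g x = c
    rw [hx, add_left_inj]
  have hnat : ∀ n : ℕ, μ (g ⁻¹' {(n : ZMod k)}) = μ (g ⁻¹' {0}) := fun n => by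
    induction n with
    | zero => rw [Nat.cast_zero]
    | succ n ih => rw [Nat.cast_succ, hstep, ih]
  have heq : ∀ c : ZMod k, μ (g ⁻¹' {c}) = μ (g ⁻¹' {0}) := fun c => by
    rw [← hnat c.val, ZMod.natCast_zmod_val]
  have hsum : ∑ c : ZMod k, μ (g ⁻¹' {c}) = 1 := by
    rw [← measure_biUnion_finset₀, ← measure_univ (μ := μ)]
    · congr 1
      ext x
      simp
    · intro a _ b _ hab
      exact Disjoint.aedisjoint (disjoint_left.2 fun x h1 h2 => hab (h1.symm.trans h2))
    · exact fun c _ => hgm c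
  simp only [heq, Finset.sum_const, Finset.card_univ, ZMod.card, nsmul_eq_mul] at hsum
  rw [heq c]
  exact ENNReal.eq_inv_of_mul_eq_one_left (by rw [mul_comm]; exact hsum)

theorem factorsOnto_cyclic_of_equivariant (hT : IsMeasurePreservingMap T μ μ) {k : ℕ} [NeZero k]
    {g : X → ZMod k} (hgm : ∀ c, NullMeasurableSet (g ⁻¹' {c}) μ)
    (hg : ∀ᵐ x ∂μ, g (T x) = g x + 1) : FactorsOnto T μ (cyclicMap k) (cyclicMeasure k) := by
  have hfib := measure_fiber_of_equivariant hT hgm hg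
  have hpre : ∀ A : Set (ZMod k), g ⁻¹' A = ⋃ c ∈ A.toFinite.toFinset, g ⁻¹' {c} := fun A => by
    ext x
    simp
  refine ⟨g, ⟨fun A _ => ?_, fun A _ => ?_⟩, hg, Filter.Eventually.of_forall fun c => ?_⟩
  · rw [hpre]
    exact Finset.nullMeasurableSet_biUnion _ fun c _ => hgm c
  · rw [hpre, measure_biUnion_finset₀]
    · simp only [hfib, Finset.sum_const, nsmul_eq_mul, cyclicMeasure, Measure.smul_apply,
        smul_eq_mul]
      rw [Measure.count_apply_finite A A.toFinite, mul_comm]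
    · intro a _ b _ hab
      exact Disjoint.aedisjoint (disjoint_left.2 fun x h1 h2 => hab (h1.symm.trans h2))
    · exact fun c _ => hgm c
  · have hne : μ (g ⁻¹' {c}) ≠ 0 := by simp [hfib]
    obtain ⟨x, hx⟩ := nonempty_of_measure_ne_zero hne
    exact ⟨x, hx⟩

end Cyclic

/-! ### Cylinders, and measure-preserving maps to the odometer -/

namespace OdometerScale

variable (K : OdometerScale)

theorem measurable_coord (n : ℕ) : Measurable fun α : K.space => α.1 n :=
  (measurable_pi_apply n).comp measurable_subtype_coe

/-- The sets on which one coordinate takes a given value. -/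
def cylinders : Set (Set K.space) := {A | ∃ n i, A = {α : K.space | α.1 n = i}}

/-- By coherence a later coordinate determines the earlier ones, so two cylinders are nested or
disjoint. -/
theorem isPiSystem_cylinders : IsPiSystem K.cylinders := by
  have key : ∀ m n, m ≤ n → ∀ (i : ZMod (K.k m)) (j : ZMod (K.k n)),
      ({α : K.space | α.1 m = i} ∩ {α : K.space | α.1 n = j}).Nonempty →
      {α : K.space | α.1 m = i} ∩ {α : K.space | α.1 n = j} = {α : K.space | α.1 n = j} := by
    rintro m n hmn i j ⟨β, hβi, hβj⟩
    refine inter_eq_right.2 fun α hα => ?_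
    change α.1 m = i
    rw [← α.2 m n hmn, show α.1 n = j from hα, ← show β.1 n = j from hβj, β.2 m n hmn]
    exact hβi
  rintro _ ⟨m, i, rfl⟩ _ ⟨n, j, rfl⟩ hne
  rcases le_total m n with h | h
  · exact ⟨n, j, key m n h i j hne⟩
  · rw [inter_comm] at hne ⊢
    exact ⟨m, i, key n m h j i hne⟩

theorem measurable_of_measurableSet_cylinder {X : Type*} [MeasurableSpace X] {f : X → K.space}
    (hf : ∀ n i, MeasurableSet {x | (f x).1 n = i}) : Measurable f :=
  (measurable_pi_iff.2 fun n => measurable_to_countable' fun i => hf n i).subtype_mk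

theorem generateFrom_cylinders :
    (inferInstance : MeasurableSpace K.space) = MeasurableSpace.generateFrom K.cylinders := by
  refine le_antisymm ?_ (MeasurableSpace.generateFrom_le ?_)
  · intro A hA
    exact @measurable_of_measurableSet_cylinder K K.space
      (MeasurableSpace.generateFrom K.cylinders) id
      (fun n i => MeasurableSpace.measurableSet_generateFrom ⟨n, i, rfl⟩) A hA
  · rintro _ ⟨n, i, rfl⟩
    exact K.measurable_coord n (measurableSet_singleton i)

variable {K} {X : Type*} [MeasurableSpace X] {T : X → X} {μ : Measure X}

/-- Each coordinate of `f` is equivariant, hence uniform, so the pushforward agrees with Haar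
measure on the generating π-system of cylinders. -/
theorem isMeasurePreservingMap_of_equivariant [IsProbabilityMeasure μ]
    (hT : IsMeasurePreservingMap T μ μ) {f : X → K.space}
    (hfm : ∀ n i, NullMeasurableSet {x | (f x).1 n = i} μ)
    (hf : ∀ᵐ x ∂μ, f (T x) = K.map (f x)) : IsMeasurePreservingMap f μ K.measure := by
  have hmeas : @Measurable (NullMeasurableSpace X μ) K.space _ _ f :=
    K.measurable_of_measurableSet_cylinder (X := NullMeasurableSpace X μ) hfm
  obtain ⟨ν, hν⟩ : ∃ ν : Measure K.space, ∀ A, MeasurableSet A → ν A = μ (f ⁻¹' A) :=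
    ⟨Measure.map (α := NullMeasurableSpace X μ) f μ.completion,
      fun A hA => Measure.map_apply hmeas hA⟩
  have hν1 : ν univ = 1 := by rw [hν _ .univ, preimage_univ, MeasureTheory.measure_univ]
  have hfin : IsFiniteMeasure ν := ⟨by rw [hν1]; exact ENNReal.one_lt_top⟩
  have heq : ν = K.measure := by
    refine ext_of_generate_finite K.cylinders K.generateFrom_cylinders K.isPiSystem_cylinders
      ?_ (by rw [hν1, K.measure_univ])
    rintro _ ⟨n, i, rfl⟩
    have hcyl : MeasurableSet {α : K.space | α.1 n = i} :=
      K.measurable_coord n (measurableSet_singleton i)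
    rw [K.measure_cylinder, hν _ hcyl]
    refine measure_fiber_of_equivariant hT (g := fun x => (f x).1 n) (hfm n) ?_ i
    filter_upwards [hf] with x hx
    rw [hx]
    rfl
  exact ⟨fun A hA => hmeas hA, fun A hA => by rw [← heq, hν A hA]⟩

/-- A measurable map to the odometer space is continuous on a closed set of almost full
measure. -/
theorem exists_isClosed_continuousOn {f : unitInterval → K.space} (hf : NullMeasurable f volume)
    {ε : ENNReal} (hε : ε ≠ 0) :
    ∃ C : Set unitInterval, IsClosed C ∧ ContinuousOn f C ∧ volume Cᶜ ≤ ε := by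
  -- One error term for each of the countably many cylinders; the preimage of each is shrunk to a
  -- closed set.
  obtain ⟨ε', hε', hsum⟩ := ENNReal.exists_pos_sum_of_countable' hε (Σ n, ZMod (K.k n))
  have hnm : ∀ p : Σ n, ZMod (K.k n), NullMeasurableSet {t | (f t).1 p.1 = p.2} volume :=
    fun p => hf (K.measurable_coord p.1 (measurableSet_singleton p.2))
  have hF : ∀ p : Σ n, ZMod (K.k n), ∃ F : Set unitInterval, F ⊆ {t | (f t).1 p.1 = p.2} ∧
      IsClosed F ∧ volume ({t | (f t).1 p.1 = p.2} \ F) ≤ ε' p := by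
    intro p
    obtain ⟨A, hAsub, hA, hAeq⟩ := (hnm p).exists_measurable_subset_ae_eq
    obtain ⟨F, hFA, hF, hlt⟩ := hA.exists_isClosed_sdiff_lt (measure_ne_top volume A) (hε' p).ne'
    refine ⟨F, hFA.trans hAsub, hF, le_trans (measure_mono_ae ?_) hlt.le⟩
    filter_upwards [hAeq] with t ht ht'
    exact ⟨ht.mpr ht'.1, ht'.2⟩
  choose F hFsub hFc hFlt using hF
  refine ⟨⋂ n, ⋃ i, F ⟨n, i⟩, isClosed_iInter fun n => isClosed_iUnion_of_finite fun i => hFc _,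
    ?_, ?_⟩
  · rw [continuousOn_iff_continuous_domRestrict]
    refine Continuous.subtype_mk (continuous_pi fun n => ?_) _
    refine IsLocallyConstant.continuous ((IsLocallyConstant.iff_isOpen_fiber).2 fun i => ?_)
    rw [← isClosed_compl_iff]
    -- On the intersection, coordinate `n` splits the set into finitely many relatively closed
    -- pieces, which are therefore also open.
    have : (((fun t : (⋂ n, ⋃ i, F ⟨n, i⟩ : Set unitInterval) => (f t.1).1 n) ⁻¹' {i})ᶜ) =
        Subtype.val ⁻¹' ⋃ j : {j // j ≠ i}, F ⟨n, j.1⟩ := by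
      ext t
      simp only [mem_compl_iff, mem_preimage, mem_singleton_iff, mem_iUnion]
      constructor
      · intro hne
        obtain ⟨j, hj⟩ := mem_iUnion.1 (mem_iInter.1 t.2 n)
        exact ⟨⟨j, fun h => hne ((hFsub _ hj).trans h)⟩, hj⟩
      · rintro ⟨j, hj⟩ h
        exact j.2 ((hFsub _ hj).symm.trans h)
    change IsClosed (((fun t : (⋂ n, ⋃ i, F ⟨n, i⟩ : Set unitInterval) => (f t.1).1 n) ⁻¹' {i})ᶜ)
    rw [this]
    exact (isClosed_iUnion_of_finite fun j => hFc _).preimage continuous_subtype_val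
  · refine le_trans (measure_mono ?_) ((measure_iUnion_le
      fun p : Σ n, ZMod (K.k n) => {t | (f t).1 p.1 = p.2} \ F p).trans
      ((ENNReal.tsum_le_tsum hFlt).trans hsum.le))
    intro t ht
    rw [mem_compl_iff, mem_iInter, not_forall] at ht
    obtain ⟨n, hn⟩ := ht
    exact mem_iUnion.2 ⟨⟨n, (f t).1 n⟩, rfl, fun h => hn (mem_iUnion.2 ⟨_, h⟩)⟩

/-- The range need not be measurable a priori, but it contains compact images of closed subsets of
the interval on which `f ∘ ψ` is continuous, and these have measure arbitrarily close to 1. -/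
theorem ae_mem_range (hX : IsStandardLebesgueSpace μ) {f : X → K.space}
    (hf : IsMeasurePreservingMap f μ K.measure) : ∀ᵐ α ∂K.measure, α ∈ range f := by
  obtain ⟨-, ψ, -, hψ, -, -⟩ := hX
  have hfψ := hf.comp hψ
  have hle : ∀ ε : ENNReal, ε ≠ 0 → K.measure (range f)ᶜ ≤ ε := by
    intro ε hε
    obtain ⟨C, hC, hcont, hlt⟩ := exists_isClosed_continuousOn hfψ.nullMeasurable hε
    have himg : IsClosed ((f ∘ ψ) '' C) := (hC.isCompact.image_of_continuousOn hcont).isClosed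
    calc K.measure (range f)ᶜ ≤ K.measure ((f ∘ ψ) '' C)ᶜ :=
          measure_mono (compl_subset_compl.2
            ((image_subset_range _ _).trans (range_comp_subset_range _ _)))
      _ = volume ((f ∘ ψ) ⁻¹' ((f ∘ ψ) '' C)ᶜ) :=
          (hfψ.measure_preimage _ himg.measurableSet.compl).symm
      _ ≤ volume Cᶜ := measure_mono (compl_subset_compl.2 (subset_preimage_image _ _))
      _ ≤ ε := hlt
  refine le_antisymm (le_of_forall_gt fun ε hε => ?_) zero_le
  obtain ⟨δ, hδ, hδε⟩ := exists_between hε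
  exact (hle δ hδ.ne').trans_lt hδε

theorem factorsOnto_cyclic_of_factorsOnto [IsProbabilityMeasure μ]
    (hT : IsMeasurePreservingMap T μ μ) (h : FactorsOnto T μ K.map K.measure) (n : ℕ) :
    FactorsOnto T μ (cyclicMap (K.k n)) (cyclicMeasure (K.k n)) := by
  obtain ⟨f, hf, heq, -⟩ := h
  refine factorsOnto_cyclic_of_equivariant hT (g := fun x => (f x).1 n)
    (fun c => hf.nullMeasurable (K.measurable_coord n (measurableSet_singleton c))) ?_
  filter_upwards [heq] with x hx
  rw [hx]
  rfl

/-- A sequence of integers whose consecutive terms are eventually congruent modulo the terms of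
the scale converges in the odometer. -/
theorem exists_limit {u : ℕ → ℤ}
    (hu : ∀ᶠ l in Filter.atTop, (u (l + 1) : ZMod (K.k l)) = u l) :
    ∃ α : K.space, ∀ n, ∀ᶠ l in Filter.atTop, (u l : ZMod (K.k n)) = α.1 n := by
  obtain ⟨L, hL⟩ := Filter.eventually_atTop.1 hu
  have hcast : ∀ {m n} (hmn : m ≤ n) (z : ℤ),
      ZMod.castHom (K.dvd_of_le hmn) (ZMod (K.k m)) z = z := fun hmn z => map_intCast _ z
  -- For `l ≥ n`, congruence mod `K.k l` implies congruence mod `K.k n`.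
  have hconst : ∀ n l, max L n ≤ l → (u l : ZMod (K.k n)) = u (max L n) := by
    intro n l hl
    induction l, hl using Nat.le_induction with
    | base => rfl
    | succ l hl ih =>
      have hnl : n ≤ l := by omega
      rw [← ih, ← hcast hnl, ← hcast hnl (u l), hL l (by omega)]
  refine ⟨⟨fun n => (u (max L n) : ZMod (K.k n)), fun m n hmn => ?_⟩, fun n =>
    Filter.eventually_atTop.2 ⟨max L n, hconst n⟩⟩
  change ZMod.castHom (K.dvd_of_le hmn) (ZMod (K.k m)) (u (max L n) : ZMod (K.k n)) = _
  rw [hcast hmn, hconst m (max L n) (by omega)]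

end OdometerScale

/-! ### The limit map as a factor map onto the odometer -/

theorem RankOneConstruction.factorsOnto_odometer {X : Type*} [MeasurableSpace X] {T : X → X}
    {μ : Measure X} (hX : IsStandardLebesgueSpace μ) (hT : IsTransformation T μ)
    (R : RankOneConstruction T μ) (K : OdometerScale) (hK : ∀ l, R.CountingCondition (K.k l)) :
    FactorsOnto T μ K.map K.measure := by
  have := hX.isProbabilityMeasure
  obtain ⟨ψ, hψm, hψ, hψT⟩ := R.exists_approximate_factor hT K hK
  have hlim : ∀ x, ∃ α : K.space,
      (∀ᶠ l in Filter.atTop, (ψ (l + 1) x : ZMod (K.k l)) = ψ l x) →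
        ∀ n, ∀ᶠ l in Filter.atTop, (ψ l x : ZMod (K.k n)) = α.1 n := by
    intro x
    by_cases hx : ∀ᶠ l in Filter.atTop, (ψ (l + 1) x : ZMod (K.k l)) = ψ l x
    · obtain ⟨α, hα⟩ := OdometerScale.exists_limit (K := K) (u := fun l => ψ l x) hx
      exact ⟨α, fun _ => hα⟩
    · exact ⟨0, fun h => absurd h hx⟩
  choose f hf using hlim
  have hae : ∀ᵐ x ∂μ, ∀ n, ∀ᶠ l in Filter.atTop, (ψ l x : ZMod (K.k n)) = (f x).1 n := by
    filter_upwards [hψ] with x hx using hf x hx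
  have hfm : ∀ n i, NullMeasurableSet {x | (f x).1 n = i} μ := by
    intro n i
    -- Almost everywhere, the limit has coordinate `i` exactly when `ψ l` is eventually congruent to
    -- `i`; this is a countable condition.
    have hnm : NullMeasurableSet (⋃ L : ℕ, ⋂ l : ℕ, ⋂ _ : L ≤ l,
        ψ l ⁻¹' {z : ℤ | (z : ZMod (K.k n)) = i}) μ :=
      .iUnion fun L => .iInter fun l => .iInter fun _ => hψm l .of_discrete
    refine hnm.congr ?_
    filter_upwards [hae] with x hx
    refine propext ?_
    change x ∈ (⋃ L : ℕ, ⋂ l : ℕ, ⋂ _ : L ≤ l, ψ l ⁻¹' {z : ℤ | (z : ZMod (K.k n)) = i}) ↔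
      (f x).1 n = i
    have hiff : x ∈ (⋃ L : ℕ, ⋂ l : ℕ, ⋂ _ : L ≤ l, ψ l ⁻¹' {z : ℤ | (z : ZMod (K.k n)) = i}) ↔
        ∀ᶠ l in Filter.atTop, (ψ l x : ZMod (K.k n)) = i := by
      simp [Filter.eventually_atTop]
    rw [hiff]
    constructor
    · intro h
      obtain ⟨l, h1, h2⟩ := (h.and (hx n)).exists
      exact h2.symm.trans h1
    · rintro rfl
      exact hx n
  have hfT : ∀ᵐ x ∂μ, f (T x) = K.map (f x) := by
    filter_upwards [hae, hT.1.ae_comp hae, hψT] with x h1 h2 h3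
    refine Subtype.ext (funext fun n => ?_)
    obtain ⟨l, ⟨hl1, hl2⟩, hl3⟩ := (((h1 n).and (h2 n)).and h3).exists
    change (f (T x)).1 n = (f x).1 n + 1
    rw [← hl1, ← hl2, hl3]
    push_cast
    rfl
  have hmp := OdometerScale.isMeasurePreservingMap_of_equivariant hT.1 hfm hfT
  exact ⟨f, hmp, hfT, OdometerScale.ae_mem_range hX hmp⟩

end

/-! ### The cycle of implications -/

theorem mainTheorem6 {X : Type*} [MeasurableSpace X] (μ : Measure X)
    (hX : IsStandardLebesgueSpace μ) (T : X → X) (hT : IsTransformation T μ)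
    (R : RankOneConstruction T μ) :
    ((∃ K : OdometerScale, FactorsOnto T μ K.map K.measure) ↔
      ∀ M : ℕ, ∃ k : ℕ, M ≤ k ∧ 1 < k ∧ R.CountingCondition k) ∧
    ((∃ K : OdometerScale, FactorsOnto T μ K.map K.measure) ↔
      ∀ M : ℕ, ∃ k : ℕ, M ≤ k ∧ 1 < k ∧ FactorsOnto T μ (cyclicMap k) (cyclicMeasure k)) := by
  have := hX.isProbabilityMeasure
  have h13 : (∃ K : OdometerScale, FactorsOnto T μ K.map K.measure) →
      ∀ M : ℕ, ∃ k : ℕ, M ≤ k ∧ 1 < k ∧ FactorsOnto T μ (cyclicMap k) (cyclicMeasure k) := by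
    rintro ⟨K, hK⟩ M
    obtain ⟨n, hn⟩ := K.unbounded M
    exact ⟨K.k n, hn, K.one_lt n, OdometerScale.factorsOnto_cyclic_of_factorsOnto hT.1 hK n⟩
  have h32 : (∀ M : ℕ, ∃ k : ℕ, M ≤ k ∧ 1 < k ∧
        FactorsOnto T μ (cyclicMap k) (cyclicMeasure k)) →
      ∀ M : ℕ, ∃ k : ℕ, M ≤ k ∧ 1 < k ∧ R.CountingCondition k := by
    intro h M
    obtain ⟨k, hMk, hk, hfac⟩ := h M
    exact ⟨k, hMk, hk, R.countingCondition_of_factorsOnto hT hk hfac⟩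
  have h21 : (∀ M : ℕ, ∃ k : ℕ, M ≤ k ∧ 1 < k ∧ R.CountingCondition k) →
      ∃ K : OdometerScale, FactorsOnto T μ K.map K.measure := by
    intro h
    obtain ⟨K, hK⟩ := R.exists_scale_of_countingCondition hT h
    exact ⟨K, R.factorsOnto_odometer hX hT K hK⟩
  exact ⟨⟨fun h => h32 (h13 h), h21⟩, ⟨h13, fun h => h21 (h32 h)⟩⟩
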